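/- Let $G$ be a finite simple graph that is bipartite with parts of sizes $n_1$ and $n_2$, put $n = n_1 + n_2$, and assume that $n \ge 4$ and that the minimum degree satisfies $\delta(G) \ge \frac12\left(\lfloor n/2\rfloor + 2\right)$. Then $$\mathrm{sn}(G) = \mathrm{gon}(G) = \min\{n_1, n_2\}.$$ In particular, for every $m \ge 4$ the crown graph on $2m$ vertices ($K_{m,m}$ with $m$ pairwise non-incident edges deleted) has gonality $m$. Here a scramble $\mathcal S$ on $G$ is a collection of nonempty connected vertex sets (eggs). Its order is $\min(h(\mathcal S), e(\mathcal S))$, where $h(\mathcal S)$ is the minimum size of a set $C \subseteq V(G)$ meeting every egg, and $e(\mathcal S)$ is the minimum of $|E(A, A^c)|$ over the sets $A \subseteq V(G)$ such that $A$ and $A^c$ each contain an egg ($\infty$ if there is no such $A$). The scramble number $\mathrm{sn}(G)$ is the maximum order of a scramble on $G$. A divisor on $G$ is a function $D : V(G) \to \mathbb Z$, its degree is $\sum_v D(v)$, and it is effective if $D(v) \ge 0$ for all $v$. The chip-firing move at $v$ lowers $D(v)$ by $\deg(v)$ and raises $D(w)$ by $1$ for each neighbour $w$ of $v$; two divisors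 are equivalent if a finite sequence of such moves transforms one into the other. The rank of $D$ is $-1$ if $D$ is not equivalent to an effective divisor, and otherwise the largest integer $r \ge 0$ such that $D - E$ is equivalent to an effective divisor for every effective divisor $E$ of degree $r$. The gonality $\mathrm{gon}(G)$ is the minimum degree of a divisor of positive rank. -/

import Mathlib

namespace GraphGonality

/-! ### Scrambles on a finite simple graph -/

section Scrambles

variable {V : Type*} [Fintype V] [DecidableEq V] (G : SimpleGraph V) [DecidableRel G.Adj]

/-- A scramble on `G`: a collection of (nonempty) connected vertex sets, called eggs. -/
structure Scramble where
  /-- The eggs of the scramble. -/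
  eggs : Finset (Finset V)
  /-- Every egg induces a connected subgraph. -/
  connected : ∀ E ∈ eggs, (G.induce (E : Set V)).Connected

variable {G}

/-- `C` is a hitting set of the scramble: it meets every egg. -/
def Scramble.IsHittingSet (S : Scramble G) (C : Finset V) : Prop :=
  ∀ E ∈ S.eggs, (C ∩ E).Nonempty

/-- `A` is an egg-cut of the scramble: `A` and its complement each contain an egg. -/
def Scramble.IsEggCut (S : Scramble G) (A : Finset V) : Prop :=
  (∃ E ∈ S.eggs, E ⊆ A) ∧ ∃ E ∈ S.eggs, E ⊆ Aᶜ

/-- `h(S)`: the minimum size of a hitting set. -/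
noncomputable def Scramble.hittingNumber (S : Scramble G) : ℕ∞ :=
  ⨅ (C : Finset V) (_ : S.IsHittingSet C), (C.card : ℕ∞)

/-- `e(S)`: the minimum size `|E(A, Aᶜ)|` of an egg-cut `A`; it is `∞` if there is no egg-cut. -/
noncomputable def Scramble.eggCutNumber (S : Scramble G) : ℕ∞ :=
  ⨅ (A : Finset V) (_ : S.IsEggCut A), ((G.interedges A Aᶜ).card : ℕ∞)

/-- The order `‖S‖ = min(h(S), e(S))` of a scramble. -/
noncomputable def Scramble.order (S : Scramble G) : ℕ∞ :=
  min S.hittingNumber S.eggCutNumber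

variable (G)

/-- The scramble number of `G`: the maximum order of a scramble on `G`
(there are only finitely many scrambles, so the supremum is attained). -/
noncomputable def scrambleNumber : ℕ∞ :=
  ⨆ S : Scramble G, S.order

end Scrambles

/-! ### Divisors, chip-firing and gonality -/

section Divisors

variable {V : Type*} [Fintype V] [DecidableEq V] (G : SimpleGraph V) [DecidableRel G.Adj]

/-- The degree of a divisor, a divisor being an integer-valued function on the vertices. -/
def divDegree (D : V → ℤ) : ℤ := ∑ v, D v

/-- A divisor is effective if all its coefficients are nonnegative. -/
def IsEffective (D : V → ℤ) : Prop := ∀ v, 0 ≤ D v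

/-- The chip-firing move at `v`: the vertex `v` sends one chip along each of its edges. -/
def fire (v : V) (D : V → ℤ) : V → ℤ := fun w =>
  if w = v then D w - (G.degree v : ℤ) else D w + (if G.Adj v w then 1 else 0)

/-- Two divisors are equivalent if a finite sequence of chip-firing moves
transforms the first one into the second one. -/
def ChipEquiv (D D' : V → ℤ) : Prop :=
  Relation.ReflTransGen (fun D₁ D₂ : V → ℤ => ∃ v, D₂ = fire G v D₁) D D'

/-- The divisor `D` is equivalent to some effective divisor. -/
def EquivToEffective (D : V → ℤ) : Prop :=
  ∃ F : V → ℤ, IsEffective F ∧ ChipEquiv G D F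

open Classical in
/-- The rank of a divisor: `-1` if it is not equivalent to an effective divisor, and otherwise the
largest `r ≥ 0` such that `D - E` is equivalent to an effective divisor for every effective `E`
of degree `r`. -/
noncomputable def rank (D : V → ℤ) : ℤ :=
  if EquivToEffective G D then
    ((sSup {r : ℕ | ∀ E : V → ℤ, IsEffective E → divDegree E = (r : ℤ) →
      EquivToEffective G (D - E)} : ℕ) : ℤ)
  else -1

/-- The (divisorial) gonality of `G`: the minimum degree of a divisor of positive rank
(such a divisor has nonnegative degree, so that the minimum may be taken in `ℕ`). -/
noncomputable def gonality : ℕ :=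
  sInf {k : ℕ | ∃ D : V → ℤ, divDegree D = (k : ℤ) ∧ 0 < rank G D}

end Divisors

/-- The crown graph on `2m` vertices: the complete bipartite graph `K_{m,m}` with the `m` pairwise
non-incident edges joining the `i`-th vertex on the left to the `i`-th vertex on the right deleted. -/
def crownGraph (m : ℕ) : SimpleGraph (Fin m ⊕ Fin m) :=
  (completeBipartiteGraph (Fin m) (Fin m)).deleteEdges
    (Set.range fun i : Fin m => s(Sum.inl i, Sum.inr i))

noncomputable instance crownGraphDecidableAdj (m : ℕ) : DecidableRel (crownGraph m).Adj :=
  Classical.decRel _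

end GraphGonality

set_option linter.unusedSectionVars false

/-! Upper bound: put one chip on each vertex of a part. To reach a vertex `b` of the other part,
fire everything except `b`: each neighbour of `b` loses one chip, and all of them lie in the chosen
part.

Lower bound: scramble number is at most gonality (`Scramble.order_le_divDegree`). Among the
effective divisors reachable from one of positive rank, take one hitting the most eggs. If it misses
an egg, move along level sets to a divisor hitting that egg. When the egg is first hit, maximality
forces another egg to have been lost; the current level set separates the two, and each edge of this
cut needs a chip.

It remains to bound the order of the scramble of all edges. With `N = ⌊n/2⌋`, a vertex cover
containing neither part contains two disjoint neighbourhoods, hence at least `2δ ≥ N + 2` vertices.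
A set of `k` vertices with `2 ≤ k ≤ N` spans at most `k²/4` edges, so at least `δk - k²/2 ≥ N + (k -
2)(N - k)/2 ≥ N` edges leave it. Both bounds are at least the size of the smaller part. -/

namespace GraphGonality

/-! ### Firing scripts and positive rank -/

section General

variable {V : Type*} [Fintype V] [DecidableEq V] (G : SimpleGraph V) [DecidableRel G.Adj]

/-- The divisor obtained from `D` by letting every vertex `v` fire `c v` times. -/
def fireScript (c : V → ℤ) (D : V → ℤ) : V → ℤ := fun v =>
  D v + ∑ w ∈ G.neighborFinset v, (c w - c v)

theorem fireScript_zero (D : V → ℤ) : fireScript G 0 D = D := by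
  funext v; simp [fireScript]

theorem fireScript_add (c d : V → ℤ) (D : V → ℤ) :
    fireScript G (c + d) D = fireScript G c (fireScript G d D) := by
  funext v
  simp only [fireScript, Pi.add_apply, add_assoc, ← Finset.sum_add_distrib]
  congr 1
  exact Finset.sum_congr rfl fun w _ => by ring

theorem fireScript_add_divisor (c : V → ℤ) (D E : V → ℤ) :
    fireScript G c (D + E) = fireScript G c D + E := by
  funext v; simp only [fireScript, Pi.add_apply]; ring

theorem fire_eq_fireScript (v : V) (D : V → ℤ) :
    fire G v D = fireScript G (Pi.single v 1) D := by
  funext w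
  by_cases h : w = v
  · subst h
    have : ∑ x ∈ G.neighborFinset w, ((Pi.single w 1 : V → ℤ) x - (Pi.single w 1 : V → ℤ) w)
        = ∑ x ∈ G.neighborFinset w, (-1 : ℤ) := by
      refine Finset.sum_congr rfl fun x hx => ?_
      have hne : x ≠ w := (G.ne_of_adj ((G.mem_neighborFinset w x).1 hx)).symm
      simp [hne]
    simp only [fire, fireScript, this]
    simp [sub_eq_add_neg]
  · simp [fire, fireScript, h, Pi.single_apply, G.adj_comm w v]

theorem sum_fireScript (c : V → ℤ) (D : V → ℤ) :
    divDegree (fireScript G c D) = divDegree D := by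
  have key : ∑ v, ∑ w ∈ G.neighborFinset v, (c w - c v) = 0 := by
    have h1 : ∀ v, ∑ w ∈ G.neighborFinset v, (c w - c v)
        = ∑ w, if G.Adj v w then c w - c v else 0 := fun v => by
      rw [← Finset.sum_filter]
      refine Finset.sum_congr ?_ fun _ _ => rfl
      ext w; simp
    -- The summand is antisymmetric in `v` and `w`.
    have h2 : ∑ v, ∑ w, (if G.Adj v w then c w - c v else 0)
        = -∑ v, ∑ w, (if G.Adj v w then c w - c v else 0) := by
      conv_lhs => rw [Finset.sum_comm]
      rw [← Finset.sum_neg_distrib]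
      refine Finset.sum_congr rfl fun v _ => ?_
      rw [← Finset.sum_neg_distrib]
      refine Finset.sum_congr rfl fun w _ => ?_
      by_cases h : G.Adj v w
      · simp [h, h.symm]
      · simp [h, G.adj_comm w v]
    simp only [h1]
    linarith
  simp only [divDegree, fireScript, Finset.sum_add_distrib, key, add_zero]

variable {G}

theorem ChipEquiv.exists_fireScript {D D' : V → ℤ} (h : ChipEquiv G D D') :
    ∃ c : V → ℤ, D' = fireScript G c D := by
  induction h with
  | refl => exact ⟨0, (fireScript_zero G D).symm⟩
  | tail _ hs ih =>
    obtain ⟨c, rfl⟩ := ih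
    obtain ⟨v, rfl⟩ := hs
    exact ⟨Pi.single v 1 + c, by rw [fireScript_add, fire_eq_fireScript]⟩

variable (G)

/-- A 0/1 script is realised by firing each vertex of `S` once. These scripts suffice for the upper
bound, so reversibility of chip-firing is not needed. -/
theorem chipEquiv_fireScript_indicator (S : Finset V) (D : V → ℤ) :
    ChipEquiv G D (fireScript G (fun v => if v ∈ S then 1 else 0) D) := by
  induction S using Finset.induction_on with
  | empty =>
    have : (fun v : V => if v ∈ (∅ : Finset V) then (1 : ℤ) else 0) = 0 := by funext v; simp
    rw [this, fireScript_zero]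
    exact Relation.ReflTransGen.refl
  | insert a S ha ih =>
    refine Relation.ReflTransGen.tail ih ⟨a, ?_⟩
    rw [fire_eq_fireScript, ← fireScript_add]
    congr 1
    funext v
    by_cases hv : v = a
    · subst hv; simp [ha]
    · simp [hv]

/-- The effective divisors equivalent to a divisor of positive rank cover all vertices. -/
theorem exists_effective_pos_of_rank_pos {D : V → ℤ} (hD : 0 < rank G D) (v : V) :
    ∃ c : V → ℤ, IsEffective (fireScript G c D) ∧ 0 < fireScript G c D v := by
  classical
  unfold rank at hD
  split_ifs at hD with h
  · set R := {r : ℕ | ∀ E : V → ℤ, IsEffective E → divDegree E = (r : ℤ) →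
      EquivToEffective G (D - E)} with hR
    have hpos : 0 < sSup R := by exact_mod_cast hD
    have hne : R.Nonempty := by
      by_contra hne
      rw [Set.not_nonempty_iff_eq_empty] at hne
      simp [hne] at hpos
    -- `sSup` of an unbounded set of naturals is the default value 0, excluded by `hpos`.
    have hbdd : BddAbove R := by
      by_contra hb
      rw [Nat.sSup_of_not_bddAbove hb] at hpos
      exact lt_irrefl _ hpos
    have hmem := Nat.sSup_mem hne hbdd
    set r := sSup R
    obtain ⟨F, hF, hDF⟩ := hmem (Pi.single v (r : ℤ))
      (fun w => by
        by_cases hw : w = v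
        · subst hw; simp
        · simp [hw])
      (by simp [divDegree])
    obtain ⟨c, rfl⟩ := hDF.exists_fireScript
    have e : fireScript G c D = fireScript G c (D - Pi.single v (r : ℤ)) + Pi.single v (r : ℤ) := by
      rw [← fireScript_add_divisor, sub_add_cancel]
    refine ⟨c, fun w => ?_, ?_⟩
    · rw [e]
      by_cases hw : w = v
      · subst hw
        have := hF w
        simp only [Pi.add_apply, Pi.single_eq_same]
        positivity
      · simpa [hw] using hF w
    · rw [e]
      have := hF v
      simp only [Pi.add_apply, Pi.single_eq_same]
      positivity
  · omega

theorem rank_pos_of_forall_exists [Nonempty V] {D : V → ℤ} (hD : IsEffective D)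
    (h : ∀ v, ∃ S : Finset V,
      IsEffective (fireScript G (fun v => if v ∈ S then 1 else 0) D) ∧
        0 < fireScript G (fun v => if v ∈ S then 1 else 0) D v) :
    0 < rank G D := by
  classical
  have h0 : EquivToEffective G D := ⟨D, hD, Relation.ReflTransGen.refl⟩
  unfold rank
  rw [if_pos h0]
  set R := {r : ℕ | ∀ E : V → ℤ, IsEffective E → divDegree E = (r : ℤ) →
      EquivToEffective G (D - E)} with hR
  -- Firing preserves degree, so `r` cannot exceed the degree of `D`.
  have hbdd : BddAbove R := by
    refine ⟨(divDegree D).toNat, fun r hr => ?_⟩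
    obtain ⟨v⟩ := ‹Nonempty V›
    obtain ⟨F, hF, hDF⟩ := hr (Pi.single v (r : ℤ))
      (fun w => by
        by_cases hw : w = v
        · subst hw; simp
        · simp [hw])
      (by simp [divDegree])
    obtain ⟨c, rfl⟩ := hDF.exists_fireScript
    have h1 : 0 ≤ divDegree (fireScript G c (D - Pi.single v (r : ℤ))) :=
      Finset.sum_nonneg fun w _ => hF w
    rw [sum_fireScript] at h1
    have h2 : divDegree (D - Pi.single v (r : ℤ)) = divDegree D - r := by
      simp [divDegree]
    omega
  have h1 : 1 ∈ R := by
    intro E hE hdeg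
    obtain ⟨v, hv⟩ : ∃ v, 0 < E v := by
      by_contra! hn
      have : divDegree E ≤ 0 := Finset.sum_nonpos fun w _ => hn w
      rw [hdeg] at this
      norm_num at this
    obtain ⟨S, hS, hSv⟩ := h v
    refine ⟨_, ?_, chipEquiv_fireScript_indicator G S (D - E)⟩
    intro w
    rw [sub_eq_add_neg, fireScript_add_divisor]
    have hw := hS w
    simp only [Pi.add_apply, Pi.neg_apply]
    -- An effective divisor of degree 1 is a single chip, here at `v`.
    have hsum : E v + ∑ x ∈ Finset.univ.erase v, E x = 1 := by
      rw [Finset.add_sum_erase _ _ (Finset.mem_univ v)]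
      simpa [divDegree] using hdeg
    have hnn : 0 ≤ ∑ x ∈ Finset.univ.erase v, E x := Finset.sum_nonneg fun x _ => hE x
    by_cases hwv : w = v
    · subst hwv
      omega
    · have : E w ≤ ∑ x ∈ Finset.univ.erase v, E x :=
        Finset.single_le_sum (fun x _ => hE x) (Finset.mem_erase.2 ⟨hwv, Finset.mem_univ w⟩)
      omega
  have := le_csSup hbdd h1
  exact_mod_cast this

/-! ### Level sets and the bound by scrambles -/

/-- A stage of the passage from `D` to an equivalent divisor along the level sets of `g`. -/
def levelStage (g : V → ℕ) (D : V → ℤ) (s : ℕ) : V → ℤ :=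
  fireScript G (fun v => -((min (g v) s : ℕ) : ℤ)) D

theorem levelStage_zero (g : V → ℕ) (D : V → ℤ) : levelStage G g D 0 = D := by
  funext v; simp [levelStage, fireScript]

/-- Truncating `g` at `s` leaves a vertex with `g v ≤ s` at least as many chips as the final divisor
has there, and any other vertex at least as many as `D`. -/
theorem levelStage_isEffective {g : V → ℕ} {D : V → ℤ} (hD : IsEffective D)
    (hD' : IsEffective (fireScript G (fun v => -(g v : ℤ)) D)) (s : ℕ) :
    IsEffective (levelStage G g D s) := by
  intro v
  by_cases h : g v ≤ s
  · refine (hD' v).trans ?_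
    simp only [levelStage, fireScript]
    refine add_le_add_right (Finset.sum_le_sum fun w _ => ?_) _
    omega
  · refine (hD v).trans ?_
    simp only [levelStage, fireScript]
    refine le_add_of_nonneg_right (Finset.sum_nonneg fun w _ => ?_)
    omega

theorem levelStage_succ_of_le {g : V → ℕ} {D : V → ℤ} {s : ℕ} {v : V} (h : g v ≤ s) :
    levelStage G g D (s + 1) v =
      levelStage G g D s v - ((G.neighborFinset v).filter (fun w => s < g w)).card := by
  simp only [levelStage, fireScript, Finset.card_filter]
  push_cast
  rw [add_sub_assoc, ← Finset.sum_sub_distrib]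
  congr 1
  refine Finset.sum_congr rfl fun w _ => ?_
  split_ifs <;> omega

theorem levelStage_succ_of_lt {g : V → ℕ} {D : V → ℤ} {s : ℕ} {v : V} (h : s < g v) :
    levelStage G g D (s + 1) v =
      levelStage G g D s v + ((G.neighborFinset v).filter (fun w => g w ≤ s)).card := by
  simp only [levelStage, fireScript, Finset.card_filter]
  push_cast
  rw [add_assoc, ← Finset.sum_add_distrib]
  congr 1
  refine Finset.sum_congr rfl fun w _ => ?_
  split_ifs <;> omega

variable {G}

/-- A connected vertex set that meets both `{v | p v}` and its complement has an edge between. -/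
theorem exists_adj_of_induce_connected {E : Finset V} (hE : (G.induce (E : Set V)).Connected)
    (p : V → Prop) {a b : V} (ha : a ∈ E) (hb : b ∈ E) (hpa : p a) (hpb : ¬ p b) :
    ∃ x ∈ E, ∃ y ∈ E, G.Adj x y ∧ p x ∧ ¬ p y := by
  obtain ⟨W⟩ := hE.preconnected ⟨a, ha⟩ ⟨b, hb⟩
  obtain ⟨d, -, h1, h2⟩ := W.exists_boundary_dart {x | p x.1} hpa hpb
  exact ⟨d.fst.1, d.fst.2, d.snd.1, d.snd.2, d.adj, h1, h2⟩

/-- A connected set that is first hit in stage `s + 1` lies outside the set fired in stage `s`. -/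
theorem lt_level_of_newly_hit {g : V → ℕ} {D : V → ℤ} {s : ℕ} {E : Finset V}
    (hE : (G.induce (E : Set V)).Connected)
    (heff : ∀ s, IsEffective (levelStage G g D s))
    (h0 : ∀ v ∈ E, levelStage G g D s v = 0)
    (h1 : ∃ v ∈ E, levelStage G g D (s + 1) v ≠ 0) : ∀ v ∈ E, s < g v := by
  obtain ⟨u, hu, hu1⟩ := h1
  have hsu : s < g u := by
    by_contra hn
    have e := levelStage_succ_of_le G (D := D) (not_lt.1 hn)
    rw [h0 u hu] at e
    have := heff (s + 1) u
    omega
  intro v hv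
  by_contra hn
  obtain ⟨x, hx, y, hy, hxy, hpx, hpy⟩ :=
    exists_adj_of_induce_connected hE (fun z => g z ≤ s) hv hu (not_lt.1 hn) (not_le.2 hsu)
  have e := levelStage_succ_of_le G (D := D) hpx
  rw [h0 x hx] at e
  have hp : 0 < ((G.neighborFinset x).filter (fun w => s < g w)).card :=
    Finset.card_pos.2 ⟨y, by simpa [hxy] using hpy⟩
  have := heff (s + 1) x
  omega

/-- A connected set that is no longer hit in stage `s + 1` lies in the set fired in stage `s`. -/
theorem level_le_of_no_longer_hit {g : V → ℕ} {D : V → ℤ} {s : ℕ} {E : Finset V}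
    (hE : (G.induce (E : Set V)).Connected)
    (heff : ∀ s, IsEffective (levelStage G g D s))
    (h0 : ∃ v ∈ E, levelStage G g D s v ≠ 0)
    (h1 : ∀ v ∈ E, levelStage G g D (s + 1) v = 0) : ∀ v ∈ E, g v ≤ s := by
  obtain ⟨u, hu, hu1⟩ := h0
  have hsu : g u ≤ s := by
    by_contra hn
    have e := levelStage_succ_of_lt G (D := D) (not_le.1 hn)
    rw [h1 u hu] at e
    have := heff s u
    omega
  intro v hv
  by_contra hn
  obtain ⟨x, hx, y, hy, hxy, hpx, hpy⟩ :=
    exists_adj_of_induce_connected hE (fun z => g z ≤ s) hu hv hsu hn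
  have e := levelStage_succ_of_lt G (D := D) (not_le.1 hpy)
  rw [h1 y hy] at e
  have hp : 0 < ((G.neighborFinset y).filter (fun w => g w ≤ s)).card :=
    Finset.card_pos.2 ⟨x, by simpa [hxy.symm] using hpx⟩
  have := heff s y
  omega

theorem card_interedges_eq_sum (A : Finset V) :
    (G.interedges A Aᶜ).card = ∑ v ∈ A, ((G.neighborFinset v).filter (· ∉ A)).card := by
  rw [SimpleGraph.interedges, Rel.interedges, Finset.card_filter, Finset.sum_product]
  refine Finset.sum_congr rfl fun v _ => ?_
  rw [← Finset.card_filter]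
  congr 1
  ext w
  simp [and_comm]

theorem card_interedges_compl_comm (A : Finset V) :
    (G.interedges A Aᶜ).card = (G.interedges Aᶜ A).card :=
  haveI := G.symm
  Rel.card_interedges_comm _ _

/-- Passing to stage `s + 1` sends one chip across each edge leaving `{g ≤ s}`. Since no debt
results, these chips were all present at stage `s`. -/
theorem card_interedges_le_degree {g : V → ℕ} {D : V → ℤ} {s : ℕ}
    (heff : ∀ s, IsEffective (levelStage G g D s)) :
    ((G.interedges (Finset.univ.filter fun v => g v ≤ s)
      (Finset.univ.filter fun v => g v ≤ s)ᶜ).card : ℤ) ≤ divDegree D := by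
  rw [card_interedges_eq_sum, ← sum_fireScript G (fun v => -((min (g v) s : ℕ) : ℤ)) D]
  change _ ≤ divDegree (levelStage G g D s)
  push_cast
  refine (Finset.sum_le_sum fun v hv => ?_).trans
    (Finset.sum_le_sum_of_subset_of_nonneg (Finset.subset_univ _) fun v _ _ => heff s v)
  have hv : g v ≤ s := by simpa using hv
  have e := levelStage_succ_of_le G (D := D) hv
  have := heff (s + 1) v
  simp only [Finset.mem_filter, Finset.mem_univ, true_and, not_le]
  omega

/-- The order of a scramble is at most the degree of any divisor of positive rank. -/
theorem Scramble.order_le_divDegree (S : Scramble G) {D : V → ℤ} {k : ℕ}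
    (hk : divDegree D = k) (hD : 0 < rank G D) : S.order ≤ k := by
  classical
  rcases isEmpty_or_nonempty V with hV | ⟨⟨v₀⟩⟩
  · refine (min_le_left _ _).trans ((iInf₂_le (∅ : Finset V) fun E hE => ?_).trans (by simp))
    obtain ⟨x⟩ := (S.connected E hE).nonempty
    exact (IsEmpty.false x.1).elim
  let hitEggs : (V → ℤ) → Finset (Finset V) := fun F => S.eggs.filter fun E => ∃ v ∈ E, F v ≠ 0
  let P : ℕ → Prop := fun j =>
    ∃ c, IsEffective (fireScript G c D) ∧ (hitEggs (fireScript G c D)).card = j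
  obtain ⟨c₀, hc₀, -⟩ := exists_effective_pos_of_rank_pos G hD v₀
  have hPb : ∀ j, P j → j ≤ S.eggs.card := by
    rintro j ⟨c, -, rfl⟩
    exact Finset.card_le_card (Finset.filter_subset _ _)
  have hP0 : P (hitEggs (fireScript G c₀ D)).card := ⟨c₀, hc₀, rfl⟩
  obtain ⟨c, hc, hcard⟩ := Nat.findGreatest_spec (hPb _ hP0) hP0
  have hmax : ∀ c', IsEffective (fireScript G c' D) →
      (hitEggs (fireScript G c' D)).card ≤ (hitEggs (fireScript G c D)).card := by
    intro c' hc'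
    rw [hcard]
    exact Nat.le_findGreatest (hPb _ ⟨c', hc', rfl⟩) ⟨c', hc', rfl⟩
  set D₀ := fireScript G c D with hD₀
  have hdeg : divDegree D₀ = k := by rw [hD₀, sum_fireScript, hk]
  by_cases hall : ∀ E ∈ S.eggs, ∃ v ∈ E, D₀ v ≠ 0
  · refine (min_le_left _ _).trans
      ((iInf₂_le (Finset.univ.filter fun v => D₀ v ≠ 0) fun E hE => ?_).trans ?_)
    · obtain ⟨v, hv, hv0⟩ := hall E hE
      exact ⟨v, by simp [hv, hv0]⟩
    · have : ((Finset.univ.filter fun v => D₀ v ≠ 0).card : ℤ) ≤ k := by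
        rw [← hdeg, Finset.card_filter, divDegree]
        push_cast
        refine Finset.sum_le_sum fun v _ => ?_
        have := hc v
        split_ifs <;> omega
      exact_mod_cast this
  push Not at hall
  obtain ⟨E₁, hE₁, hE₁0⟩ := hall
  obtain ⟨⟨v, hv⟩⟩ := (S.connected E₁ hE₁).nonempty
  obtain ⟨c', hc', hc'v⟩ := exists_effective_pos_of_rank_pos G hD v
  -- Adding a constant to a script changes nothing, so the script may be taken as `-g` with `g`
  -- natural-valued.
  obtain ⟨M, hM⟩ : ∃ M : ℤ, ∀ w, (c' - c) w ≤ M := by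
    obtain ⟨M, hM⟩ := (Set.finite_range (c' - c)).bddAbove
    exact ⟨M, fun w => hM ⟨w, rfl⟩⟩
  let g : V → ℕ := fun w => (M - (c' - c) w).toNat
  have hg : ∀ w, (g w : ℤ) = M - (c' - c) w := fun w =>
    Int.toNat_of_nonneg (sub_nonneg.2 (hM w))
  have hlast : fireScript G (fun w => -(g w : ℤ)) D₀ = fireScript G c' D := by
    have : fireScript G c' D = fireScript G (c' - c) D₀ := by
      rw [hD₀, ← fireScript_add, sub_add_cancel]
    rw [this]
    funext w
    simp only [fireScript, hg]
    congr 1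
    exact Finset.sum_congr rfl fun x _ => by ring
  have heff : ∀ s, IsEffective (levelStage G g D₀ s) :=
    levelStage_isEffective G hc (by rw [hlast]; exact hc')
  have hex : ∃ s, ∃ v ∈ E₁, levelStage G g D₀ s v ≠ 0 := by
    obtain ⟨s, hs⟩ := (Set.finite_range g).bddAbove
    refine ⟨s, v, hv, ?_⟩
    have : levelStage G g D₀ s = fireScript G c' D := by
      rw [← hlast, levelStage]
      congr 1
      funext w
      rw [min_eq_left (hs ⟨w, rfl⟩)]
    rw [this]
    exact hc'v.ne'
  obtain ⟨s, hs⟩ : ∃ s, Nat.find hex = s + 1 := by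
    refine Nat.exists_eq_succ_of_ne_zero fun h0 => ?_
    obtain ⟨w, hw, hw0⟩ := Nat.find_spec hex
    rw [h0, levelStage_zero] at hw0
    exact hw0 (hE₁0 w hw)
  have hs1 : ∃ v ∈ E₁, levelStage G g D₀ (s + 1) v ≠ 0 := hs ▸ Nat.find_spec hex
  have hs0 : ∀ v ∈ E₁, levelStage G g D₀ s v = 0 := by
    have := Nat.find_min hex (m := s) (by omega)
    push Not at this
    exact this
  have hE₁cut := lt_level_of_newly_hit (S.connected E₁ hE₁) heff hs0 hs1
  obtain ⟨E₂, hE₂, hE₂0, hE₂1⟩ : ∃ E₂ ∈ S.eggs, (∃ v ∈ E₂, D₀ v ≠ 0) ∧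
      ∀ v ∈ E₂, levelStage G g D₀ (s + 1) v = 0 := by
    by_contra! hn
    have hss : hitEggs D₀ ⊂ hitEggs (levelStage G g D₀ (s + 1)) := by
      refine Finset.ssubset_iff_of_subset (fun E hE => ?_) |>.2 ⟨E₁, ?_, ?_⟩
      · simp only [hitEggs, Finset.mem_filter] at hE ⊢
        exact ⟨hE.1, hn E hE.1 hE.2⟩
      · simp only [hitEggs, Finset.mem_filter]
        exact ⟨hE₁, hs1⟩
      · simp only [hitEggs, Finset.mem_filter]
        rintro ⟨-, w, hw, hw0⟩
        exact hw0 (hE₁0 w hw)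
    have hlt := Finset.card_lt_card hss
    have he : levelStage G g D₀ (s + 1) =
        fireScript G ((fun v => -((min (g v) (s + 1) : ℕ) : ℤ)) + c) D := by
      rw [fireScript_add]; rfl
    rw [he] at hlt
    exact absurd (hmax _ (he ▸ heff (s + 1))) (not_le.2 hlt)
  have hE₂cut : ∀ v ∈ E₂, g v ≤ s := by
    -- `E₂` may be lost before stage `s + 1`, but the level sets increase, so an earlier one
    -- containing it suffices.
    have hex2 : ∃ l, ∀ v ∈ E₂, levelStage G g D₀ l v = 0 := ⟨_, hE₂1⟩
    have hle : Nat.find hex2 ≤ s + 1 := Nat.find_min' hex2 hE₂1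
    obtain ⟨l, hl⟩ : ∃ l, Nat.find hex2 = l + 1 := by
      refine Nat.exists_eq_succ_of_ne_zero fun h0 => ?_
      obtain ⟨w, hw, hw0⟩ := hE₂0
      have := Nat.find_spec hex2 w hw
      rw [h0, levelStage_zero] at this
      exact hw0 this
    have hl0 := Nat.find_min hex2 (m := l) (by omega)
    push Not at hl0
    have := level_le_of_no_longer_hit (S.connected E₂ hE₂) heff hl0 (hl ▸ Nat.find_spec hex2)
    exact fun w hw => (this w hw).trans (by omega)
  refine (min_le_right _ _).trans
    ((iInf₂_le (Finset.univ.filter fun v => g v ≤ s) ⟨⟨E₂, hE₂, fun w hw => ?_⟩,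
      ⟨E₁, hE₁, fun w hw => ?_⟩⟩).trans ?_)
  · have := card_interedges_le_degree (G := G) (D := D₀) (s := s) heff
    rw [hdeg] at this
    exact_mod_cast this
  · simpa using hE₂cut w hw
  · simpa using hE₁cut w hw

variable (G)

/-- The scramble number is a lower bound for the gonality of a graph that has a divisor of
positive rank and nonnegative degree. -/
theorem scrambleNumber_le_gonality
    (hne : ∃ k : ℕ, ∃ D : V → ℤ, divDegree D = (k : ℤ) ∧ 0 < rank G D) :
    scrambleNumber G ≤ gonality G := by
  obtain ⟨D, hdeg, hD⟩ : ∃ D : V → ℤ, divDegree D = (gonality G : ℤ) ∧ 0 < rank G D :=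
    Nat.sInf_mem hne
  exact iSup_le fun S => S.order_le_divDegree hdeg hD

end General

/-! ### Bipartite graphs and the edge scramble -/

section Bipartite

variable {V : Type*} [Fintype V] [DecidableEq V] {G : SimpleGraph V} [DecidableRel G.Adj]

/-- In a bipartite graph without isolated vertices, one chip on every vertex of one of the parts
gives a divisor of positive rank. -/
theorem rank_pos_of_isBipartiteWith [Nonempty V] {A B : Finset V}
    (hG : G.IsBipartiteWith (A : Set V) (B : Set V)) (hAB : A ∪ B = Finset.univ)
    (hδ : 0 < G.minDegree) :
    0 < rank G (fun v => if v ∈ A then 1 else 0) := by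
  have hmem : ∀ v, v ∉ A → v ∈ B := fun v hv => by
    have := Finset.mem_univ v
    rw [← hAB, Finset.mem_union] at this
    exact this.resolve_left hv
  refine rank_pos_of_forall_exists G (fun v => by split_ifs <;> norm_num) fun b => ?_
  by_cases hb : b ∈ A
  · refine ⟨∅, ?_, ?_⟩
    · intro v
      simp only [fireScript, Finset.notMem_empty, if_false, sub_self, Finset.sum_const_zero,
        add_zero]
      split_ifs <;> norm_num
    · simp [fireScript, hb]
  have hval : fireScript G (fun v => if v ∈ Finset.univ.erase b then 1 else 0)
      (fun v => if v ∈ A then 1 else 0) b = G.degree b := by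
    have : ∀ w ∈ G.neighborFinset b, ((if w ∈ Finset.univ.erase b then (1 : ℤ) else 0)
        - (if b ∈ Finset.univ.erase b then 1 else 0)) = 1 := fun w hw => by
      have hne : w ≠ b := (G.ne_of_adj ((G.mem_neighborFinset b w).1 hw)).symm
      simp [hne]
    simp only [fireScript]
    rw [Finset.sum_congr rfl this]
    simp [hb]
  have hdb : (0 : ℤ) < G.degree b := by
    exact_mod_cast hδ.trans_le (G.minDegree_le_degree b)
  refine ⟨Finset.univ.erase b, fun v => ?_, by rw [hval]; exact hdb⟩
  by_cases hvb : v = b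
  · subst hvb
    rw [hval]; exact hdb.le
  have hsum : ∑ w ∈ G.neighborFinset v, ((if w ∈ Finset.univ.erase b then (1 : ℤ) else 0)
      - (if v ∈ Finset.univ.erase b then 1 else 0)) = if G.Adj v b then -1 else 0 := by
    have : ∀ w ∈ G.neighborFinset v, ((if w ∈ Finset.univ.erase b then (1 : ℤ) else 0)
        - (if v ∈ Finset.univ.erase b then 1 else 0)) = if w = b then -1 else 0 := fun w _ => by
      by_cases hwb : w = b <;> simp [hwb, hvb]
    rw [Finset.sum_congr rfl this]
    simp
  simp only [fireScript]
  rw [hsum]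
  by_cases hadj : G.Adj v b
  · have hvA : v ∈ A := by
      by_contra hvA
      exact Set.disjoint_left.1 hG.disjoint (hG.mem_of_mem_adj' (hmem v hvA) hadj.symm)
        (hmem b hb)
    simp [hadj, hvA]
  · simp only [hadj, if_false, add_zero]
    split_ifs <;> norm_num

variable (G) in
/-- The scramble whose eggs are the edges of the graph. -/
noncomputable def edgeScramble : Scramble G where
  eggs := by
    classical
    exact Finset.univ.filter fun E => ∃ x y, G.Adj x y ∧ E = {x, y}
  connected := by
    classical
    intro E hE
    obtain ⟨x, y, hxy, rfl⟩ := (Finset.mem_filter.1 hE).2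
    rw [Finset.coe_pair]
    exact SimpleGraph.induce_pair_connected_of_adj hxy

theorem mem_edgeScramble_eggs {E : Finset V} :
    E ∈ (edgeScramble G).eggs ↔ ∃ x y, G.Adj x y ∧ E = {x, y} := by
  classical
  simp [edgeScramble]

/-- A vertex cover of a bipartite graph contains a part or has at least `2δ(G)` elements. -/
theorem min_le_card_of_vertexCover {A B C : Finset V}
    (hG : G.IsBipartiteWith (A : Set V) (B : Set V))
    (hC : ∀ x y, G.Adj x y → x ∈ C ∨ y ∈ C) :
    min (min A.card B.card) (2 * G.minDegree) ≤ C.card := by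
  by_cases hA : A ⊆ C
  · have := Finset.card_le_card hA
    omega
  by_cases hB : B ⊆ C
  · have := Finset.card_le_card hB
    omega
  obtain ⟨a, haA, haC⟩ := Finset.not_subset.1 hA
  obtain ⟨b, hbB, hbC⟩ := Finset.not_subset.1 hB
  have h1 : G.neighborFinset a ⊆ C := fun x hx =>
    (hC a x ((G.mem_neighborFinset a x).1 hx)).resolve_left haC
  have h2 : G.neighborFinset b ⊆ C := fun x hx =>
    (hC b x ((G.mem_neighborFinset b x).1 hx)).resolve_left hbC
  have hd : Disjoint (G.neighborFinset a) (G.neighborFinset b) := by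
    rw [Finset.disjoint_left]
    -- A common neighbour of `a` and `b` would lie in both parts.
    intro x hxa hxb
    rw [SimpleGraph.mem_neighborFinset] at hxa hxb
    exact Set.disjoint_left.1 hG.disjoint (hG.mem_of_mem_adj' hbB hxb.symm)
      (hG.mem_of_mem_adj haA hxa)
  have := Finset.card_le_card (Finset.union_subset h1 h2)
  rw [Finset.card_union_of_disjoint hd, SimpleGraph.card_neighborFinset_eq_degree,
    SimpleGraph.card_neighborFinset_eq_degree] at this
  have := G.minDegree_le_degree a
  have := G.minDegree_le_degree b
  omega

/-- The number of edges leaving a set of vertices of a bipartite graph. -/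
theorem card_interedges_ge_of_isBipartiteWith {A B X : Finset V}
    (hG : G.IsBipartiteWith (A : Set V) (B : Set V)) (hAB : A ∪ B = Finset.univ) :
    (G.minDegree : ℤ) * X.card - 2 * ((X ∩ A).card * (X ∩ B).card) ≤
      (G.interedges X Xᶜ).card := by
  have hdis : Disjoint (X ∩ A) (X ∩ B) :=
    (Finset.disjoint_coe.1 hG.disjoint).mono Finset.inter_subset_right Finset.inter_subset_right
  have hX : (X ∩ A) ∪ (X ∩ B) = X := by
    rw [← Finset.inter_union_distrib_left, hAB, Finset.inter_univ]
  have hcard : X.card = (X ∩ A).card + (X ∩ B).card := by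
    rw [← Finset.card_union_of_disjoint hdis, hX]
  have hout : ∀ v, ∀ Y : Finset V, (∀ w ∈ X, G.Adj v w → w ∈ Y) →
      (G.minDegree : ℤ) - Y.card ≤ ((G.neighborFinset v).filter (· ∉ X)).card := by
    intro v Y hY
    have h1 := Finset.card_filter_add_card_filter_not (s := G.neighborFinset v) (· ∈ X)
    have h2 : ((G.neighborFinset v).filter (· ∈ X)).card ≤ Y.card := by
      refine Finset.card_le_card fun w hw => ?_
      rw [Finset.mem_filter, SimpleGraph.mem_neighborFinset] at hw
      exact hY w hw.2 hw.1
    rw [SimpleGraph.card_neighborFinset_eq_degree] at h1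
    have := G.minDegree_le_degree v
    omega
  have hA : ((X ∩ A).card : ℤ) * (G.minDegree - (X ∩ B).card) ≤
      ∑ v ∈ X ∩ A, (((G.neighborFinset v).filter (· ∉ X)).card : ℤ) := by
    rw [← nsmul_eq_mul]
    refine Finset.card_nsmul_le_sum _ _ _ fun v hv => hout v _ fun w hw hvw => ?_
    exact Finset.mem_inter.2 ⟨hw, hG.mem_of_mem_adj (Finset.mem_inter.1 hv).2 hvw⟩
  have hB : ((X ∩ B).card : ℤ) * (G.minDegree - (X ∩ A).card) ≤
      ∑ v ∈ X ∩ B, (((G.neighborFinset v).filter (· ∉ X)).card : ℤ) := by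
    rw [← nsmul_eq_mul]
    refine Finset.card_nsmul_le_sum _ _ _ fun v hv => hout v _ fun w hw hvw => ?_
    exact Finset.mem_inter.2 ⟨hw, hG.symm.mem_of_mem_adj (Finset.mem_inter.1 hv).2 hvw⟩
  have hsum : ((G.interedges X Xᶜ).card : ℤ) =
      ∑ v ∈ X ∩ A, (((G.neighborFinset v).filter (· ∉ X)).card : ℤ) +
      ∑ v ∈ X ∩ B, (((G.neighborFinset v).filter (· ∉ X)).card : ℤ) := by
    rw [← Finset.sum_union hdis, hX, card_interedges_eq_sum]
    push_cast
    rfl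
  rw [hsum, hcard]
  push_cast
  linarith

/-- A set of between two and half of the vertices of a bipartite graph of large minimum degree is
left by at least half as many edges as there are vertices. -/
theorem half_card_le_card_interedges {A B X : Finset V}
    (hG : G.IsBipartiteWith (A : Set V) (B : Set V)) (hAB : A ∪ B = Finset.univ)
    (hδ : Fintype.card V / 2 + 2 ≤ 2 * G.minDegree) (hX2 : 2 ≤ X.card)
    (hX : X.card ≤ Fintype.card V / 2) :
    Fintype.card V / 2 ≤ (G.interedges X Xᶜ).card := by
  have key := card_interedges_ge_of_isBipartiteWith (X := X) hG hAB
  have hcard : X.card = (X ∩ A).card + (X ∩ B).card := by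
    rw [← Finset.card_union_of_disjoint ((Finset.disjoint_coe.1 hG.disjoint).mono
      Finset.inter_subset_right Finset.inter_subset_right), ← Finset.inter_union_distrib_left,
      hAB, Finset.inter_univ]
  set N := Fintype.card V / 2
  zify at *
  have h1 : 4 * (((X ∩ A).card : ℤ) * (X ∩ B).card) ≤ (X.card : ℤ) ^ 2 := by
    rw [hcard]; nlinarith [sq_nonneg (((X ∩ A).card : ℤ) - (X ∩ B).card)]
  -- This product is exactly the slack left by the minimum degree bound and AM-GM.
  have h2 : 0 ≤ ((X.card : ℤ) - 2) * (N - X.card) :=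
    mul_nonneg (by linarith) (by linarith)
  have h3 : ((N : ℤ) + 2) * X.card ≤ 2 * G.minDegree * X.card :=
    mul_le_mul_of_nonneg_right hδ (by positivity)
  nlinarith

theorem min_card_le_scrambleNumber {A B : Finset V}
    (hG : G.IsBipartiteWith (A : Set V) (B : Set V)) (hAB : A ∪ B = Finset.univ)
    (hδ : Fintype.card V / 2 + 2 ≤ 2 * G.minDegree) :
    ((min A.card B.card : ℕ) : ℕ∞) ≤ scrambleNumber G := by
  have hcard : A.card + B.card = Fintype.card V := by
    rw [← Finset.card_union_of_disjoint (Finset.disjoint_coe.1 hG.disjoint), hAB,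
      Finset.card_univ]
  refine le_trans ?_ (le_iSup _ (edgeScramble G))
  refine le_min (le_iInf₂ fun C hC => ?_) (le_iInf₂ fun X hX => ?_)
  · have := min_le_card_of_vertexCover (C := C) hG fun x y hxy => by
      obtain ⟨z, hz⟩ := hC {x, y} (mem_edgeScramble_eggs.2 ⟨x, y, hxy, rfl⟩)
      simp only [Finset.mem_inter, Finset.mem_insert, Finset.mem_singleton] at hz
      rcases hz with ⟨hz, rfl | rfl⟩
      · exact Or.inl hz
      · exact Or.inr hz
    exact_mod_cast (show min A.card B.card ≤ C.card by omega)
  · have two_le : ∀ Y : Finset V, (∃ E ∈ (edgeScramble G).eggs, E ⊆ Y) → 2 ≤ Y.card := by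
      rintro Y ⟨E, hE, hEY⟩
      obtain ⟨x, y, hxy, rfl⟩ := mem_edgeScramble_eggs.1 hE
      exact (Finset.card_pair hxy.ne).symm.le.trans (Finset.card_le_card hEY)
    have h1 := two_le X hX.1
    have h2 := two_le Xᶜ hX.2
    have h3 := Finset.card_add_card_compl X
    have : Fintype.card V / 2 ≤ (G.interedges X Xᶜ).card := by
      -- `X` or its complement has at most half the vertices, and both have the same cut.
      by_cases hle : X.card ≤ Fintype.card V / 2
      · exact half_card_le_card_interedges hG hAB hδ h1 hle
      · have := half_card_le_card_interedges hG hAB hδ h2 (by omega)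
        rwa [compl_compl, ← card_interedges_compl_comm] at this
    exact_mod_cast (show min A.card B.card ≤ (G.interedges X Xᶜ).card by omega)

theorem scrambleNumber_eq_gonality_eq_min {A B : Finset V}
    (hG : G.IsBipartiteWith (A : Set V) (B : Set V)) (hAB : A ∪ B = Finset.univ)
    (hV : 4 ≤ Fintype.card V) (hδ : Fintype.card V / 2 + 2 ≤ 2 * G.minDegree) :
    scrambleNumber G = (gonality G : ℕ∞) ∧ gonality G = min A.card B.card := by
  have : Nonempty V := Fintype.card_pos_iff.1 (by omega)
  have hrank : ∀ {A B : Finset V}, G.IsBipartiteWith (A : Set V) (B : Set V) →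
      A ∪ B = Finset.univ → A.card ∈ {k : ℕ | ∃ D : V → ℤ, divDegree D = (k : ℤ) ∧ 0 < rank G D} :=
    fun h h' => ⟨_, by simp [divDegree], rank_pos_of_isBipartiteWith h h' (by omega)⟩
  have hA := hrank hG hAB
  have hB := hrank hG.symm (by rwa [Finset.union_comm])
  have h1 : gonality G ≤ min A.card B.card := le_min (Nat.sInf_le hA) (Nat.sInf_le hB)
  have h2 := scrambleNumber_le_gonality G ⟨_, hA⟩
  have h3 := min_card_le_scrambleNumber hG hAB hδ
  have h4 : min A.card B.card ≤ gonality G := by exact_mod_cast h3.trans h2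
  have h5 : gonality G = min A.card B.card := le_antisymm h1 h4
  exact ⟨le_antisymm h2 (h5 ▸ h3), h5⟩

end Bipartite

/-! ### Crown graphs -/

section Crown

theorem crownGraph_adj_inl_inr {m : ℕ} {i j : Fin m} :
    (crownGraph m).Adj (Sum.inl i) (Sum.inr j) ↔ i ≠ j := by
  simp [crownGraph, SimpleGraph.deleteEdges_adj]

theorem not_crownGraph_adj_inl_inl {m : ℕ} {i j : Fin m} :
    ¬ (crownGraph m).Adj (Sum.inl i) (Sum.inl j) := by
  simp [crownGraph, SimpleGraph.deleteEdges_adj]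

theorem not_crownGraph_adj_inr_inr {m : ℕ} {i j : Fin m} :
    ¬ (crownGraph m).Adj (Sum.inr i) (Sum.inr j) := by
  simp [crownGraph, SimpleGraph.deleteEdges_adj]

theorem crownGraph_isBipartiteWith (m : ℕ) :
    (crownGraph m).IsBipartiteWith
      ((Finset.univ.map Function.Embedding.inl : Finset (Fin m ⊕ Fin m)) : Set (Fin m ⊕ Fin m))
      ((Finset.univ.map Function.Embedding.inr : Finset (Fin m ⊕ Fin m)) :
        Set (Fin m ⊕ Fin m)) where
  disjoint := by
    rw [Finset.disjoint_coe, Finset.disjoint_left]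
    simp
  mem_of_adj := by
    rintro (i | i) (j | j) h
    · exact absurd h not_crownGraph_adj_inl_inl
    · simp
    · simp
    · exact absurd h not_crownGraph_adj_inr_inr

theorem le_minDegree_crownGraph {m : ℕ} (hm : 0 < m) : m - 1 ≤ (crownGraph m).minDegree := by
  have : Nonempty (Fin m ⊕ Fin m) := ⟨Sum.inl ⟨0, hm⟩⟩
  refine SimpleGraph.le_minDegree_of_forall_le_degree _ _ ?_
  rintro (i | i)
  · calc m - 1 = ((Finset.univ.erase i).map Function.Embedding.inr :
          Finset (Fin m ⊕ Fin m)).card := by simp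
      _ ≤ _ := Finset.card_le_card fun x hx => by
        simp only [Finset.mem_map, Finset.mem_erase, Finset.mem_univ, and_true] at hx
        obtain ⟨j, hj, rfl⟩ := hx
        rw [SimpleGraph.mem_neighborFinset]
        exact crownGraph_adj_inl_inr.2 hj.symm
  · calc m - 1 = ((Finset.univ.erase i).map Function.Embedding.inl :
          Finset (Fin m ⊕ Fin m)).card := by simp
      _ ≤ _ := Finset.card_le_card fun x hx => by
        simp only [Finset.mem_map, Finset.mem_erase, Finset.mem_univ, and_true] at hx
        obtain ⟨j, hj, rfl⟩ := hx
        rw [SimpleGraph.mem_neighborFinset]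
        exact (crownGraph_adj_inl_inr.2 hj).symm

theorem gonality_crownGraph {m : ℕ} (hm : 4 ≤ m) : gonality (crownGraph m) = m := by
  have hδ := le_minDegree_crownGraph (m := m) (by omega)
  have hc : Fintype.card (Fin m ⊕ Fin m) = m + m := by simp
  -- The degree condition follows from `m + 2 ≤ 2 * (m - 1)`, which is `4 ≤ m`.
  have := (scrambleNumber_eq_gonality_eq_min (crownGraph_isBipartiteWith m)
    (by ext (i | i) <;> simp) (by omega) (by omega)).2
  simpa using this

end Crown

end GraphGonality

theorem mainTheorem7 :
    (∀ (V : Type*) [Fintype V] [DecidableEq V] (G : SimpleGraph V) [DecidableRel G.Adj]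
      (A B : Finset V) (n₁ n₂ n : ℕ),
      G.IsBipartiteWith (A : Set V) (B : Set V) → A ∪ B = Finset.univ →
      A.card = n₁ → B.card = n₂ → n = n₁ + n₂ → 4 ≤ n →
      (1 / 2 : ℝ) * (((n / 2 : ℕ) : ℝ) + 2) ≤ (G.minDegree : ℝ) →
      GraphGonality.scrambleNumber G = ((GraphGonality.gonality G : ℕ) : ℕ∞) ∧
        GraphGonality.gonality G = min n₁ n₂) ∧
    (∀ m : ℕ, 4 ≤ m → GraphGonality.gonality (GraphGonality.crownGraph m) = m) := by
  refine ⟨?_, fun m hm => GraphGonality.gonality_crownGraph hm⟩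
  rintro V _ _ G _ A B _ _ n hG hAB rfl rfl hn h4 hδ
  have hcard : Fintype.card V = n := by
    rw [hn, ← Finset.card_union_of_disjoint (Finset.disjoint_coe.1 hG.disjoint), hAB,
      Finset.card_univ]
  have hδ' : n / 2 + 2 ≤ 2 * G.minDegree := by
    have : (((n / 2 : ℕ) : ℝ) + 2) ≤ 2 * (G.minDegree : ℝ) := by linarith
    exact_mod_cast this
  subst hcard
  exact GraphGonality.scrambleNumber_eq_gonality_eq_min hG hAB h4 hδ'
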